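/- For a positive integer $k$ let $a^{1,<}_{\mathbb{Z}^d}(k)$ denote the number of subrings $S$ of $\mathbb{Z}^d$ (with componentwise addition and multiplication) that contain the identity $(1,\dots,1)$ and have index $[\mathbb{Z}^d:S]=k$ as additive subgroups. Let $d\ge 6$. Then there is a polynomial $D\in\mathbb{R}[x]$ (depending only on $d$) such that for all primes $p$ and all integers $l\ge 0$ $$a^{1,<}_{\mathbb{Z}^d}(p^l)\le D(l)\,p^{\left(\frac d2-\frac53\right)l}.$$ Consequently, for each $\epsilon>0$ there is a constant $C>0$ (depending only on $d$ and $\epsilon$) such that for all integers $k\ge 1$ $$a^{1,<}_{\mathbb{Z}^d}(k)\le C\,k^{\frac d2-\frac53+\epsilon}.$$ -/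

import Mathlib

/-- The number of unital subrings `S` of the ring `R` (subrings containing the identity of `R`)
whose index `[R : S]`, as an additive subgroup, equals `k`. -/
noncomputable def unitalSubringCount (R : Type*) [Ring R] (k : ℕ) : ℕ :=
  Nat.card {S : Subring R // S.toAddSubgroup.index = k}

/-- For `k ≥ 1` the set of unital subrings of `ℤ^d` of index `k` is finite, so that
`unitalSubringCount (Fin d → ℤ) k` is its true cardinality. -/
theorem finite_subrings_of_index (d k : ℕ) (hk : k ≠ 0) :
    Finite {S : Subring (Fin d → ℤ) // S.toAddSubgroup.index = k} := by
  have : NeZero k := ⟨hk⟩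
  have mem : ∀ S : Subring (Fin d → ℤ), S.toAddSubgroup.index = k →
      ∀ x : Fin d → ℤ, k • x ∈ S := fun S hS x => by
    have := S.toAddSubgroup.nsmul_index_mem x
    rwa [hS] at this
  let r : (Fin d → ℤ) → (Fin d → ZMod k) := fun x i => (x i : ZMod k)
  refine Finite.of_injective
    (fun S : {S : Subring (Fin d → ℤ) // S.toAddSubgroup.index = k} =>
      (r '' (S.1 : Set (Fin d → ℤ)) : Set (Fin d → ZMod k))) ?_
  have key : ∀ S T : {S : Subring (Fin d → ℤ) // S.toAddSubgroup.index = k},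
      r '' (S.1 : Set (Fin d → ℤ)) = r '' (T.1 : Set (Fin d → ℤ)) → S.1 ≤ T.1 := by
    intro S T h x hx
    have hx' : r x ∈ r '' (T.1 : Set (Fin d → ℤ)) := h ▸ ⟨x, hx, rfl⟩
    obtain ⟨y, hy, hxy⟩ := hx'
    have hdiv : ∀ i, ∃ c : ℤ, x i - y i = k * c := fun i => by
      have : ((x i - y i : ℤ) : ZMod k) = 0 := by
        have h1 := congrFun hxy i
        simp only [r] at h1
        push_cast
        rw [h1, sub_self]
      exact (ZMod.intCast_zmod_eq_zero_iff_dvd _ k).1 this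
    choose c hc using hdiv
    have hx2 : x = y + k • c := by
      funext i
      have := hc i
      have e : (k • c) i = (k : ℤ) * c i := by simp
      rw [Pi.add_apply, e]
      linarith
    rw [hx2]
    exact T.1.add_mem hy (mem T.1 T.2 c)
  intro S T h
  exact Subtype.ext (le_antisymm (key S T h) (key T S h.symm))

/-! Let `R` be a unital subring of ℤ^d of index p^l. Multiplying an upper by a lower triangular
system of elements of `R` gives elements on the axes, so the axis indices have product dividing
p^(2l) (`Subring.prod_axisIndex_dvd`), and some axis index is p^k with dk ≤ 2l. Forgetting that
coordinate leaves a unital subring S of ℤ^(d-1) of index p^(l-k), and `R` is recovered from S and a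
unital homomorphism S → ℤ/p^k. Such a homomorphism is fixed by d-2 successive roots of monic
quadratics, each with at most 2p^⌊k/2⌋ choices.

This recursion (`unitalSubringCount_prime_pow_le_sum`) gives the exponent (d-2)/3 up to a polynomial
factor in l, and (d-2)/3 ≤ d/2 - 5/3 exactly when d ≥ 6. Submultiplicativity of the count over
coprime indices then yields the bound for all k. -/

/-! ### Triangular elements of subgroups of ℤ^n. -/

theorem AddSubgroup.index_eq_index_map_mul_relIndex_ker {A B : Type*} [AddCommGroup A]
    [AddCommGroup B] (f : A →+ B) (hf : Function.Surjective f) (H : AddSubgroup A) :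
    H.index = (H.map f).index * H.relIndex f.ker := by
  rw [AddSubgroup.index_map, AddMonoidHom.range_eq_top.2 hf, AddSubgroup.index_top, mul_one,
    ← AddSubgroup.relIndex_mul_index (le_sup_left : H ≤ H ⊔ f.ker), mul_comm,
    sup_comm, AddSubgroup.relIndex_sup_right]

/-- Prepending a zero coordinate, as an additive homomorphism. -/
def consZeroHom (n : ℕ) : (Fin n → ℤ) →+ (Fin (n + 1) → ℤ) where
  toFun x := Fin.cons 0 x
  map_zero' := by ext j; refine Fin.cases ?_ (fun j => ?_) j <;> simp
  map_add' x y := by ext j; refine Fin.cases ?_ (fun j => ?_) j <;> simp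

theorem consZeroHom_apply {n : ℕ} (x : Fin n → ℤ) : consZeroHom n x = Fin.cons 0 x := rfl

theorem consZeroHom_tail {n : ℕ} {x : Fin (n + 1) → ℤ} (hx : x 0 = 0) :
    consZeroHom n (Fin.tail x) = x := by
  rw [consZeroHom_apply, ← hx, Fin.cons_self_tail]

theorem range_consZeroHom (n : ℕ) :
    (consZeroHom n).range = (Pi.evalAddMonoidHom (fun _ : Fin (n + 1) => ℤ) 0).ker := by
  ext x
  constructor
  · rintro ⟨y, rfl⟩
    simp [AddMonoidHom.mem_ker, consZeroHom_apply]
  · intro hx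
    exact ⟨Fin.tail x, consZeroHom_tail hx⟩

theorem consZeroHom_mul {n : ℕ} (x y : Fin n → ℤ) :
    consZeroHom n (x * y) = consZeroHom n x * consZeroHom n y := by
  ext j; refine Fin.cases ?_ (fun j => ?_) j <;> simp [consZeroHom_apply]

/-- An additive subgroup of `ℤ^n` contains triangular elements whose diagonal has product the
index. -/
theorem AddSubgroup.exists_triangular {n : ℕ} (H : AddSubgroup (Fin n → ℤ)) :
    ∃ x : Fin n → Fin n → ℤ, (∀ a, x a ∈ H) ∧ (∀ a b, b < a → x a b = 0) ∧
      ∃ f : Fin n → ℕ, (∀ a, x a a = f a) ∧ ∏ a, f a = H.index := by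
  induction n with
  | zero =>
    refine ⟨fun a => a.elim0, fun a => a.elim0, fun a => a.elim0, fun a => a.elim0,
      fun a => a.elim0, ?_⟩
    have : H = ⊤ := Subsingleton.elim _ _
    simp [this]
  | succ n ih =>
    obtain ⟨x, hx, hx0, f, hf, hprod⟩ := ih (H.comap (consZeroHom n))
    let e := Pi.evalAddMonoidHom (fun _ : Fin (n + 1) => ℤ) 0
    have he : Function.Surjective e := fun z => ⟨fun _ => z, rfl⟩
    obtain ⟨v, hv, hv0⟩ : (((H.map e).index : ℕ) : ℤ) ∈ H.map e := by
      simpa using (H.map e).nsmul_index_mem 1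
    refine ⟨Fin.cons v fun a => consZeroHom n (x a), ?_, ?_,
      Fin.cons (H.map e).index f, ?_, ?_⟩
    · intro a
      refine Fin.cases ?_ (fun a => ?_) a
      · simpa using hv
      · simpa using hx a
    · intro a b
      refine Fin.cases ?_ (fun a => ?_) a
      · intro h; exact absurd h (Fin.not_lt_zero b)
      · refine Fin.cases ?_ (fun b => ?_) b
        · simp [consZeroHom_apply]
        · intro h; simpa [consZeroHom_apply] using hx0 a b (Fin.succ_lt_succ_iff.1 h)
    · intro a
      refine Fin.cases ?_ (fun a => ?_) a
      · exact hv0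
      · simpa [consZeroHom_apply] using hf a
    · rw [Fin.prod_univ_succ, AddSubgroup.index_eq_index_map_mul_relIndex_ker e he H,
        ← range_consZeroHom, ← AddSubgroup.index_comap, ← hprod]
      simp

theorem AddSubgroup.exists_triangular_rev {n : ℕ} (H : AddSubgroup (Fin n → ℤ)) :
    ∃ x : Fin n → Fin n → ℤ, (∀ a, x a ∈ H) ∧ (∀ a b, a < b → x a b = 0) ∧
      ∃ f : Fin n → ℕ, (∀ a, x a a = f a) ∧ ∏ a, f a = H.index := by
  let r : (Fin n → ℤ) →+ (Fin n → ℤ) :=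
    AddMonoidHom.pi fun j => Pi.evalAddMonoidHom (fun _ : Fin n => ℤ) (Fin.rev j)
  have hr : Function.Surjective r := fun x =>
    ⟨fun j => x (Fin.rev j), by ext j; exact congrArg x (Fin.rev_rev j)⟩
  obtain ⟨x, hx, hx0, f, hf, hprod⟩ := (H.comap r).exists_triangular
  refine ⟨fun a => r (x (Fin.rev a)), fun a => hx _, fun a b h => ?_, fun a => f (Fin.rev a),
    fun a => hf _, ?_⟩
  · exact hx0 _ _ (Fin.rev_lt_rev.2 h)
  · rw [← AddSubgroup.index_comap_of_surjective H hr, ← hprod]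
    exact Equiv.prod_comp Fin.revPerm f

/-! ### Axis indices. -/

/-- The index in `ℤ` of the intersection of `H` with the `i`-th coordinate axis. -/
noncomputable def AddSubgroup.axisIndex {n : ℕ} (H : AddSubgroup (Fin n → ℤ)) (i : Fin n) : ℕ :=
  (H.comap (AddMonoidHom.single (fun _ : Fin n => ℤ) i)).index

theorem AddSubgroup.single_mem_iff {n : ℕ} (H : AddSubgroup (Fin n → ℤ)) (i : Fin n) (z : ℤ) :
    Pi.single i z ∈ H ↔ (H.axisIndex i : ℤ) ∣ z := by
  set K := H.comap (AddMonoidHom.single (fun _ : Fin n => ℤ) i) with hK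
  have h : z ∈ K ↔ (K.index : ℤ) ∣ z := by
    obtain ⟨g, hg⟩ := Int.subgroup_cyclic K
    rw [← AddSubgroup.zmultiples_eq_closure] at hg
    rw [hg, Int.index_zmultiples, Int.mem_zmultiples_iff, Int.natAbs_dvd]
  exact h

theorem AddSubgroup.axisIndex_dvd_index {n : ℕ} (H : AddSubgroup (Fin n → ℤ)) (i : Fin n) :
    H.axisIndex i ∣ H.index := by
  rw [AddSubgroup.axisIndex, AddSubgroup.index_comap]
  exact AddSubgroup.relIndex_dvd_index_of_normal _ _

/-- The product of the `i`-th elements of two opposite triangular systems is supported on axis `i`,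
with entry `f i * g i`; each diagonal multiplies to the index, whence the square. -/
theorem Subring.prod_axisIndex_dvd {n : ℕ} (R : Subring (Fin n → ℤ)) :
    ∏ i, R.toAddSubgroup.axisIndex i ∣ R.toAddSubgroup.index ^ 2 := by
  obtain ⟨x, hx, hx0, f, hf, hfp⟩ := R.toAddSubgroup.exists_triangular
  obtain ⟨y, hy, hy0, g, hg, hgp⟩ := R.toAddSubgroup.exists_triangular_rev
  rw [sq]
  nth_rw 1 [← hfp]
  rw [← hgp, ← Finset.prod_mul_distrib]
  refine Finset.prod_dvd_prod_of_dvd _ _ fun i _ => ?_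
  have h : x i * y i ∈ R.toAddSubgroup := R.mul_mem (hx i) (hy i)
  have e : x i * y i = Pi.single i ((f i * g i : ℕ) : ℤ) := by
    ext j
    rcases lt_trichotomy j i with h | rfl | h
    · simp [hx0 i j h, h.ne]
    · simp [hf, hg]
    · simp [hy0 i j h, h.ne']
  rw [e, AddSubgroup.single_mem_iff] at h
  exact_mod_cast h

/-! ### Quadratic equations modulo prime powers. -/

theorem Prime.pow_dvd_or_pow_dvd_of_pow_dvd_mul {p u v : ℤ} (hp : Prime p) {c e k : ℕ}
    (hk : c + e ≤ k + 1) (h : p ^ k ∣ u * v) : p ^ c ∣ u ∨ p ^ e ∣ v := by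
  by_contra! hn
  have hu := emultiplicity_lt_iff_not_dvd.2 hn.1
  have hv := emultiplicity_lt_iff_not_dvd.2 hn.2
  have huv := le_emultiplicity_of_pow_dvd h
  rw [emultiplicity_mul hp] at huv
  lift emultiplicity p u to ℕ using hu.ne_top with a
  lift emultiplicity p v to ℕ using hv.ne_top with b
  norm_cast at hu hv huv
  omega

theorem exists_code_of_ncard_le {α : Type*} [Finite α] {B : ℕ} [NeZero B] (s : Set α)
    (h : s.ncard ≤ B) : ∃ code : α → Fin B, Set.InjOn code s := by
  classical
  have := Fintype.ofFinite α
  have : Nonempty (s ↪ Fin B) := by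
    apply Function.Embedding.nonempty_of_card_le
    rwa [Fintype.card_fin, ← Nat.card_eq_fintype_card, Nat.card_coe_set_eq]
  obtain ⟨g⟩ := this
  refine ⟨fun a => if ha : a ∈ s then g ⟨a, ha⟩ else 0, fun a ha b hb hab => ?_⟩
  simpa [ha, hb] using hab

/-- A monic quadratic equation modulo `p ^ k` has at most `2 * p ^ (k / 2)` solutions. -/
theorem ZMod.ncard_quadratic_le {p : ℕ} (hp : p.Prime) (k : ℕ) (b c : ZMod (p ^ k)) :
    {x : ZMod (p ^ k) | x * x = b * x + c}.ncard ≤ 2 * p ^ (k / 2) := by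
  classical
  have : NeZero (p ^ k) := ⟨(pow_pos hp.pos k).ne'⟩
  rcases Set.eq_empty_or_nonempty {x : ZMod (p ^ k) | x * x = b * x + c} with h | ⟨x₀, h₀⟩
  · simp [h]
  have key : ∀ x y : ZMod (p ^ k), (∃ u : ℤ, (p : ℤ) ^ (k - k / 2) ∣ u ∧ x - y = u) →
      ∃ t ∈ Finset.range (p ^ (k / 2)), x = y + (p : ZMod (p ^ k)) ^ (k - k / 2) * (t : ℕ) := by
    rintro x y ⟨_, ⟨t, rfl⟩, hxy⟩
    have hpos : (0 : ℤ) < (p : ℤ) ^ (k / 2) := pow_pos (by exact_mod_cast hp.pos) _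
    refine ⟨(t % (p ^ (k / 2) : ℤ)).toNat, ?_, ?_⟩
    · rw [Finset.mem_range]
      zify
      rw [Int.toNat_of_nonneg (Int.emod_nonneg _ hpos.ne')]
      exact Int.emod_lt_of_pos _ hpos
    · have h1 : (((t % (p ^ (k / 2) : ℤ)).toNat : ℕ) : ZMod (p ^ k)) =
          ((t % (p ^ (k / 2) : ℤ) : ℤ) : ZMod (p ^ k)) := by
        rw [← Int.cast_natCast, Int.toNat_of_nonneg (Int.emod_nonneg _ hpos.ne')]
      have h2 : (p : ZMod (p ^ k)) ^ (k - k / 2) * (p : ZMod (p ^ k)) ^ (k / 2) = 0 := by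
        rw [← pow_add, Nat.sub_add_cancel (Nat.div_le_self k 2)]
        exact_mod_cast ZMod.natCast_self (p ^ k)
      rw [h1, Int.emod_def]
      push_cast at hxy ⊢
      linear_combination hxy + (t / (p ^ (k / 2) : ℤ) : ℤ) * h2
  let F (y : ZMod (p ^ k)) : Finset (ZMod (p ^ k)) :=
    (Finset.range (p ^ (k / 2))).image fun t : ℕ => y + (p : ZMod (p ^ k)) ^ (k - k / 2) * t
  have hF : ∀ y, (F y).card ≤ p ^ (k / 2) := fun y =>
    Finset.card_image_le.trans (Finset.card_range _).le
  have hsub : {x : ZMod (p ^ k) | x * x = b * x + c} ⊆ ((F x₀ ∪ F (b - x₀) : Finset _) : Set _) := by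
    intro x hx
    have h0 : (x - x₀) * (x - (b - x₀)) = 0 := by
      have h1 : x * x = b * x + c := hx
      have h2 : x₀ * x₀ = b * x₀ + c := h₀
      linear_combination h1 - h2
    obtain ⟨u, hu⟩ := ZMod.intCast_surjective (x - x₀)
    obtain ⟨v, hv⟩ := ZMod.intCast_surjective (x - (b - x₀))
    rw [← hu, ← hv, ← Int.cast_mul, ZMod.intCast_zmod_eq_zero_iff_dvd] at h0
    push_cast at h0
    have hmem : ∀ y, (∃ u : ℤ, (p : ℤ) ^ (k - k / 2) ∣ u ∧ x - y = u) → x ∈ F y := by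
      intro y h
      obtain ⟨t, ht, hxt⟩ := key x y h
      exact Finset.mem_image.2 ⟨t, ht, hxt.symm⟩
    simp only [Finset.coe_union, Set.mem_union, Finset.mem_coe]
    rcases (Nat.prime_iff_prime_int.1 hp).pow_dvd_or_pow_dvd_of_pow_dvd_mul
      (c := k - k / 2) (e := k - k / 2) (by omega) h0 with h | h
    · exact Or.inl (hmem _ ⟨u, h, hu.symm⟩)
    · exact Or.inr (hmem _ ⟨v, h, hv.symm⟩)
  calc _ ≤ ((F x₀ ∪ F (b - x₀) : Finset _) : Set (ZMod (p ^ k))).ncard :=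
        Set.ncard_le_ncard hsub (Finset.finite_toSet _)
    _ ≤ _ := by
      rw [Set.ncard_coe_finset, two_mul]
      exact (Finset.card_union_le _ _).trans (add_le_add (hF _) (hF _))

/-! ### Counting homomorphisms into ℤ/m. -/

/-- `φ` restricts to an additive and multiplicative map on `T`. -/
structure IsRingHomOn {A B : Type*} [Ring A] [Ring B] (T : AddSubgroup A) (φ : A → B) : Prop where
  map_add : ∀ x ∈ T, ∀ y ∈ T, φ (x + y) = φ x + φ y
  map_mul : ∀ x ∈ T, ∀ y ∈ T, φ (x * y) = φ x * φ y

theorem IsRingHomOn.map_zsmul {A B : Type*} [Ring A] [Ring B] {T : AddSubgroup A} {φ : A → B}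
    (h : IsRingHomOn T φ) {x : A} (hx : x ∈ T) (z : ℤ) : φ (z • x) = z • φ x := by
  let g : T →+ B := AddMonoidHom.mk' (fun x => φ x) fun x y => h.map_add x x.2 y y.2
  exact _root_.map_zsmul g z ⟨x, hx⟩

theorem IsRingHomOn.comp_consZeroHom {B : Type*} [Ring B] {n : ℕ}
    {T : AddSubgroup (Fin (n + 1) → ℤ)} {φ : (Fin (n + 1) → ℤ) → B} (h : IsRingHomOn T φ) :
    IsRingHomOn (T.comap (consZeroHom n)) (φ ∘ consZeroHom n) where
  map_add x hx y hy := by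
    simpa using h.map_add _ hx _ hy
  map_mul x hx y hy := by
    simpa [consZeroHom_mul] using h.map_mul _ hx _ hy

/-- Each coordinate costs one choice among at most `B` roots. The maps are total functions of which
only the restriction to `T` matters. -/
theorem exists_code_ringHomOn {m B : ℕ}
    (hB : ∀ b c : ZMod m, ∃ code : ZMod m → Fin B, Set.InjOn code {x | x * x = b * x + c})
    {n : ℕ} (T : AddSubgroup (Fin n → ℤ)) (hT : ∀ x ∈ T, ∀ y ∈ T, x * y ∈ T) :
    ∃ code : ((Fin n → ℤ) → ZMod m) → (Fin n → Fin B), ∀ φ ψ, IsRingHomOn T φ →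
      IsRingHomOn T ψ → code φ = code ψ → Set.EqOn φ ψ T := by
  induction n with
  | zero =>
    refine ⟨fun _ a => a.elim0, fun φ ψ hφ hψ _ x hx => ?_⟩
    have h0 : x = (0 : ℤ) • x := Subsingleton.elim _ _
    rw [h0, hφ.map_zsmul hx, hψ.map_zsmul hx, zero_smul, zero_smul]
  | succ n ih =>
    choose root hroot using hB
    obtain ⟨code, hcode⟩ := ih (T.comap (consZeroHom n)) fun x hx y hy => by
      simpa [consZeroHom_mul] using hT _ hx _ hy
    let e := Pi.evalAddMonoidHom (fun _ : Fin (n + 1) => ℤ) 0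
    obtain ⟨g, hg⟩ := Int.subgroup_cyclic (T.map e)
    rw [← AddSubgroup.zmultiples_eq_closure] at hg
    obtain ⟨v, hv, hv0⟩ : g ∈ T.map e := hg ▸ AddSubgroup.mem_zmultiples g
    have hv0' : v 0 = g := hv0
    -- Since `v 0 = g`, this lies in the part of `T` with zero first coordinate, where induction
    -- determines `φ`; so `φ v` is a root of a quadratic already known.
    set w := v * v - g • v with hw
    have hwT : w ∈ T := T.sub_mem (hT v hv v hv) (T.zsmul_mem hv g)
    have hw0 : w 0 = 0 := by simp [hw, hv0']
    have quad : ∀ φ : (Fin (n + 1) → ℤ) → ZMod m, IsRingHomOn T φ →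
        φ v ∈ {x | x * x = (g : ZMod m) * x + φ w} := by
      intro φ hφ
      have e1 : v * v = g • v + w := by rw [hw]; abel
      rw [Set.mem_ofPred_eq, ← hφ.map_mul v hv v hv, e1,
        hφ.map_add _ (T.zsmul_mem hv g) _ hwT, hφ.map_zsmul hv, zsmul_eq_mul]
    refine ⟨fun φ => Fin.cons (root g (φ w) (φ v)) (code (φ ∘ consZeroHom n)),
      fun φ ψ hφ hψ hc => ?_⟩
    obtain ⟨hc0, hc1⟩ := Fin.cons_inj.1 hc
    have htail : ∀ x ∈ T, x 0 = 0 → φ x = ψ x := by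
      intro x hx hx0
      have := hcode _ _ hφ.comp_consZeroHom hψ.comp_consZeroHom hc1
        (x := Fin.tail x) (by simpa [consZeroHom_tail hx0] using hx)
      simpa [consZeroHom_tail hx0] using this
    have hvv : φ v = ψ v := by
      have hqψ := quad ψ hψ
      rw [htail w hwT hw0] at hc0
      refine hroot _ _ ?_ hqψ hc0
      rw [← htail w hwT hw0]
      exact quad φ hφ
    intro x hx
    obtain ⟨z, hz⟩ : ∃ z : ℤ, z • g = x 0 :=
      AddSubgroup.mem_zmultiples_iff.1 (hg ▸ ⟨x, hx, rfl⟩)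
    have hzv := T.zsmul_mem hv z
    have hxT := T.sub_mem hx hzv
    have hx0 : (x - z • v) 0 = 0 := by
      simp only [Pi.sub_apply, Pi.smul_apply, hv0', hz, sub_self]
    rw [← add_sub_cancel (z • v) x, hφ.map_add _ hzv _ hxT, hψ.map_add _ hzv _ hxT,
      hφ.map_zsmul hv, hψ.map_zsmul hv, hvv, htail _ hxT hx0]

/-- Subtracting `x 0 • 1` moves any element into the part with zero first coordinate, so the unit
saves one factor `B`. -/
theorem exists_code_unital_ringHomOn {m B : ℕ}
    (hB : ∀ b c : ZMod m, ∃ code : ZMod m → Fin B, Set.InjOn code {x | x * x = b * x + c})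
    {n : ℕ} (S : Subring (Fin (n + 1) → ℤ)) :
    ∃ code : ((Fin (n + 1) → ℤ) → ZMod m) → (Fin n → Fin B), ∀ φ ψ,
      IsRingHomOn S.toAddSubgroup φ → IsRingHomOn S.toAddSubgroup ψ → φ 1 = ψ 1 →
      code φ = code ψ → Set.EqOn φ ψ S := by
  obtain ⟨code, hcode⟩ := exists_code_ringHomOn hB (S.toAddSubgroup.comap (consZeroHom n))
    fun x hx y hy => by simpa [consZeroHom_mul] using S.mul_mem hx hy
  refine ⟨fun φ => code (φ ∘ consZeroHom n), fun φ ψ hφ hψ h1 hc x hx => ?_⟩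
  have hS1 : (1 : Fin (n + 1) → ℤ) ∈ S.toAddSubgroup := S.one_mem
  have hz := S.toAddSubgroup.zsmul_mem hS1 (x 0)
  have hxT := S.toAddSubgroup.sub_mem hx hz
  have hx0 : (x - x 0 • (1 : Fin (n + 1) → ℤ)) 0 = 0 := by simp
  have := hcode _ _ hφ.comp_consZeroHom hψ.comp_consZeroHom hc
    (x := Fin.tail (x - x 0 • (1 : Fin (n + 1) → ℤ)))
    (by rw [AddSubgroup.coe_comap, Set.mem_preimage, consZeroHom_tail hx0]; exact hxT)
  simp only [Function.comp_apply, consZeroHom_tail hx0] at this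
  rw [← add_sub_cancel (x 0 • (1 : Fin (n + 1) → ℤ)) x, hφ.map_add _ hz _ hxT,
    hψ.map_add _ hz _ hxT, hφ.map_zsmul hS1, hψ.map_zsmul hS1, h1, this]

/-! ### Recovering a subring from a projection and a gluing map. -/

/-- The projection of `ℤ^(n+1)` that forgets the coordinate `i`. -/
def forgetHom {n : ℕ} (i : Fin (n + 1)) : (Fin (n + 1) → ℤ) →+* (Fin n → ℤ) :=
  RingHom.pi fun j => Pi.evalRingHom (fun _ : Fin (n + 1) => ℤ) (i.succAbove j)

theorem forgetHom_apply {n : ℕ} (i : Fin (n + 1)) (x : Fin (n + 1) → ℤ) (j : Fin n) :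
    forgetHom i x j = x (i.succAbove j) := rfl

theorem forgetHom_surjective {n : ℕ} (i : Fin (n + 1)) : Function.Surjective (forgetHom i) :=
  fun x => ⟨i.insertNth 0 x, by ext j; simp [forgetHom_apply]⟩

theorem eq_single_of_forgetHom_eq_zero {n : ℕ} {i : Fin (n + 1)} {x : Fin (n + 1) → ℤ}
    (h : forgetHom i x = 0) : x = Pi.single i (x i) := by
  ext j
  rcases Fin.eq_self_or_eq_succAbove i j with rfl | ⟨j, rfl⟩
  · simp
  · simpa [forgetHom_apply] using congrFun h j

theorem ker_forgetHom {n : ℕ} (i : Fin (n + 1)) :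
    (forgetHom i : (Fin (n + 1) → ℤ) →+ (Fin n → ℤ)).ker =
      (AddMonoidHom.single (fun _ : Fin (n + 1) => ℤ) i).range := by
  ext x
  constructor
  · intro h
    exact ⟨x i, (eq_single_of_forgetHom_eq_zero h).symm⟩
  · rintro ⟨z, rfl⟩
    ext j
    simp [forgetHom_apply]

theorem Subring.index_eq_index_map_forgetHom_mul {n : ℕ} (R : Subring (Fin (n + 1) → ℤ))
    (i : Fin (n + 1)) : R.toAddSubgroup.index =
      (R.map (forgetHom i)).toAddSubgroup.index * R.toAddSubgroup.axisIndex i := by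
  have h := AddSubgroup.index_eq_index_map_mul_relIndex_ker
    (forgetHom i : (Fin (n + 1) → ℤ) →+ (Fin n → ℤ)) (forgetHom_surjective i) R.toAddSubgroup
  rw [ker_forgetHom, ← AddSubgroup.index_comap] at h
  exact h

open Classical in
/-- The `i`-th coordinate of elements of `R`, modulo `m`, as a function of the others. -/
noncomputable def Subring.gluing {n : ℕ} (m : ℕ) (i : Fin (n + 1)) (R : Subring (Fin (n + 1) → ℤ))
    (x : Fin n → ℤ) : ZMod m :=
  -- The choice is immaterial when `m` is the axis index; 0 is a default value off the projection of
  -- `R`.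
  if h : ∃ y ∈ R, forgetHom i y = x then (h.choose i : ZMod m) else 0

theorem Subring.gluing_forgetHom {n : ℕ} {m : ℕ} {i : Fin (n + 1)}
    {R : Subring (Fin (n + 1) → ℤ)} (hm : R.toAddSubgroup.axisIndex i = m)
    {y : Fin (n + 1) → ℤ} (hy : y ∈ R) : R.gluing m i (forgetHom i y) = y i := by
  have h : ∃ z ∈ R, forgetHom i z = forgetHom i y := ⟨y, hy, rfl⟩
  rw [Subring.gluing, dif_pos h]
  have h0 : forgetHom i (h.choose - y) = 0 := by rw [map_sub, h.choose_spec.2, sub_self]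
  have h1 : h.choose - y ∈ R.toAddSubgroup := R.sub_mem h.choose_spec.1 hy
  rw [eq_single_of_forgetHom_eq_zero h0, AddSubgroup.single_mem_iff, hm,
    ← ZMod.intCast_zmod_eq_zero_iff_dvd] at h1
  rw [← sub_eq_zero, ← Int.cast_sub]
  exact h1

theorem Subring.isRingHomOn_gluing {n : ℕ} {m : ℕ} {i : Fin (n + 1)}
    {R : Subring (Fin (n + 1) → ℤ)} (hm : R.toAddSubgroup.axisIndex i = m) :
    IsRingHomOn (R.map (forgetHom i)).toAddSubgroup (R.gluing m i) where
  map_add := by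
    rintro _ ⟨x, hx, rfl⟩ _ ⟨y, hy, rfl⟩
    change R.gluing m i (forgetHom i x + forgetHom i y) =
      R.gluing m i (forgetHom i x) + R.gluing m i (forgetHom i y)
    rw [← map_add, gluing_forgetHom hm hx, gluing_forgetHom hm hy,
      gluing_forgetHom hm (R.add_mem hx hy)]
    simp
  map_mul := by
    rintro _ ⟨x, hx, rfl⟩ _ ⟨y, hy, rfl⟩
    change R.gluing m i (forgetHom i x * forgetHom i y) =
      R.gluing m i (forgetHom i x) * R.gluing m i (forgetHom i y)
    rw [← map_mul, gluing_forgetHom hm hx, gluing_forgetHom hm hy,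
      gluing_forgetHom hm (R.mul_mem hx hy)]
    simp

theorem Subring.gluing_one {n : ℕ} {m : ℕ} {i : Fin (n + 1)}
    {R : Subring (Fin (n + 1) → ℤ)} (hm : R.toAddSubgroup.axisIndex i = m) :
    R.gluing m i 1 = 1 := by
  rw [← map_one (forgetHom i), gluing_forgetHom hm R.one_mem]
  simp

/-- If `x ∈ R` and `y ∈ R'` have the same projection, `x - y` lies on axis `i` with entry divisible
by `m`, hence in `R'`. -/
theorem Subring.le_of_gluing_eqOn {n : ℕ} {m : ℕ} {i : Fin (n + 1)}
    {R R' : Subring (Fin (n + 1) → ℤ)} (hm : R.toAddSubgroup.axisIndex i = m)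
    (hm' : R'.toAddSubgroup.axisIndex i = m) (hmap : R.map (forgetHom i) = R'.map (forgetHom i))
    (h : Set.EqOn (R.gluing m i) (R'.gluing m i) (R.map (forgetHom i))) : R ≤ R' := by
  intro x hx
  have hxm : forgetHom i x ∈ R.map (forgetHom i) := ⟨x, hx, rfl⟩
  obtain ⟨y, hy, hyx⟩ : forgetHom i x ∈ R'.map (forgetHom i) := hmap ▸ hxm
  have hyx' : forgetHom i y = forgetHom i x := hyx
  have h1 := h hxm
  rw [gluing_forgetHom hm hx, ← hyx', gluing_forgetHom hm' hy, ← sub_eq_zero, ← Int.cast_sub,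
    ZMod.intCast_zmod_eq_zero_iff_dvd] at h1
  have h0 : forgetHom i (x - y) = 0 := by rw [map_sub, hyx', sub_self]
  have h2 : x - y ∈ R'.toAddSubgroup := by
    rw [eq_single_of_forgetHom_eq_zero h0, AddSubgroup.single_mem_iff, hm']
    exact h1
  simpa using R'.add_mem h2 hy

theorem ncard_subrings_axisIndex_le {m B : ℕ}
    (hB : ∀ b c : ZMod m, ∃ code : ZMod m → Fin B, Set.InjOn code {x | x * x = b * x + c})
    (hm : m ≠ 0) {n N : ℕ} (hN : N ≠ 0) (i : Fin (n + 2)) :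
    {R : Subring (Fin (n + 2) → ℤ) | R.toAddSubgroup.index = N * m ∧
      R.toAddSubgroup.axisIndex i = m}.ncard ≤
      unitalSubringCount (Fin (n + 1) → ℤ) N * B ^ n := by
  choose code hcode using exists_code_unital_ringHomOn hB (n := n)
  have := finite_subrings_of_index (n + 1) N hN
  let F : {R : Subring (Fin (n + 2) → ℤ) | R.toAddSubgroup.index = N * m ∧
      R.toAddSubgroup.axisIndex i = m} →
      {S : Subring (Fin (n + 1) → ℤ) // S.toAddSubgroup.index = N} × (Fin n → Fin B) :=
    fun R => (⟨R.1.map (forgetHom i), by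
      have h := R.1.index_eq_index_map_forgetHom_mul i
      rw [R.2.1, R.2.2] at h
      exact (Nat.eq_of_mul_eq_mul_right (Nat.pos_of_ne_zero hm) h).symm⟩,
      code (R.1.map (forgetHom i)) (R.1.gluing m i))
  have hF : Function.Injective F := by
    rintro ⟨R, hR, hRm⟩ ⟨R', hR', hRm'⟩ h
    have hmap : R.map (forgetHom i) = R'.map (forgetHom i) :=
      congrArg (fun z => z.1.1) h
    have hc : code (R.map (forgetHom i)) (R.gluing m i) =
        code (R'.map (forgetHom i)) (R'.gluing m i) := congrArg Prod.snd h
    rw [← hmap] at hc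
    have heq := hcode _ _ _ (Subring.isRingHomOn_gluing hRm)
      (hmap ▸ Subring.isRingHomOn_gluing hRm')
      ((Subring.gluing_one hRm).trans (Subring.gluing_one hRm').symm) hc
    exact Subtype.ext (le_antisymm (Subring.le_of_gluing_eqOn hRm hRm' hmap heq)
      (Subring.le_of_gluing_eqOn hRm' hRm hmap.symm (hmap ▸ heq.symm)))
  have h := Nat.card_le_card_of_injective F hF
  rw [Nat.card_prod, Nat.card_fun, Nat.card_fin, Nat.card_fin] at h
  exact h

/-! ### The recursion and the bound at prime powers. -/

theorem Subring.exists_axisIndex_eq_pow {d p l : ℕ} [NeZero d] (hp : p.Prime)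
    (R : Subring (Fin d → ℤ)) (hR : R.toAddSubgroup.index = p ^ l) :
    ∃ i : Fin d, ∃ k ≤ l, d * k ≤ 2 * l ∧ R.toAddSubgroup.axisIndex i = p ^ k := by
  have h : ∀ i, ∃ k ≤ l, R.toAddSubgroup.axisIndex i = p ^ k := fun i =>
    (Nat.dvd_prime_pow hp).1 (hR ▸ R.toAddSubgroup.axisIndex_dvd_index i)
  choose k hkl hk using h
  obtain ⟨i, hi⟩ := Finite.exists_min k
  refine ⟨i, k i, hkl i, ?_, hk i⟩
  have hdvd := R.prod_axisIndex_dvd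
  simp only [hk, hR, Finset.prod_pow_eq_pow_sum, ← pow_mul] at hdvd
  have hle := (Nat.pow_dvd_pow_iff_le_right hp.one_lt).1 hdvd
  have h : d * k i ≤ ∑ j, k j := by
    simpa using Finset.card_nsmul_le_sum Finset.univ k (k i) fun j _ => hi j
  rw [mul_comm l 2] at hle
  exact h.trans hle

theorem unitalSubringCount_prime_pow_le_sum {n p : ℕ} (hp : p.Prime) (l : ℕ) :
    unitalSubringCount (Fin (n + 2) → ℤ) (p ^ l) ≤
      ∑ _i : Fin (n + 2), ∑ k ∈ (Finset.range (l + 1)).filter fun k => (n + 2) * k ≤ 2 * l,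
        unitalSubringCount (Fin (n + 1) → ℤ) (p ^ (l - k)) * (2 * p ^ (k / 2)) ^ n := by
  let X : Fin (n + 2) × ℕ → Set (Subring (Fin (n + 2) → ℤ)) := fun a =>
    {R | R.toAddSubgroup.index = p ^ l ∧ R.toAddSubgroup.axisIndex a.1 = p ^ a.2}
  set K := (Finset.range (l + 1)).filter fun k => (n + 2) * k ≤ 2 * l with hK
  have hfin : {R : Subring (Fin (n + 2) → ℤ) | R.toAddSubgroup.index = p ^ l}.Finite :=
    finite_subrings_of_index (n + 2) (p ^ l) (pow_pos hp.pos l).ne'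
  have hsub : {R : Subring (Fin (n + 2) → ℤ) | R.toAddSubgroup.index = p ^ l} ⊆
      ⋃ a ∈ (Finset.univ ×ˢ K : Finset (Fin (n + 2) × ℕ)), X a := by
    intro R hR
    obtain ⟨i, k, hkl, hk, hi⟩ := R.exists_axisIndex_eq_pow hp hR
    refine Set.mem_biUnion (x := (i, k)) ?_ ⟨hR, hi⟩
    simp [hK, hk, hkl]
  have hfin' : (⋃ a ∈ (Finset.univ ×ˢ K : Finset (Fin (n + 2) × ℕ)), X a).Finite :=
    hfin.subset (Set.iUnion₂_subset fun a _ R hR => hR.1)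
  calc unitalSubringCount (Fin (n + 2) → ℤ) (p ^ l)
      = {R : Subring (Fin (n + 2) → ℤ) | R.toAddSubgroup.index = p ^ l}.ncard := rfl
    _ ≤ _ := Set.ncard_le_ncard hsub hfin'
    _ ≤ _ := Finset.set_ncard_biUnion_le _ _
    _ = ∑ i : Fin (n + 2), ∑ k ∈ K, (X (i, k)).ncard := Finset.sum_product _ _ _
    _ ≤ _ := Finset.sum_le_sum fun i _ => Finset.sum_le_sum fun k hk => ?_
  have hkl : k ≤ l := by
    have := (Finset.mem_filter.1 hk).1
    rw [Finset.mem_range] at this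
    omega
  have hpk := (pow_pos hp.pos k).ne'
  have : NeZero (p ^ k) := ⟨hpk⟩
  have : NeZero (2 * p ^ (k / 2)) := ⟨(Nat.mul_pos two_pos (pow_pos hp.pos _)).ne'⟩
  have h := ncard_subrings_axisIndex_le (m := p ^ k)
    (fun b c => exists_code_of_ncard_le _ (ZMod.ncard_quadratic_le hp k b c)) hpk
    (pow_pos hp.pos (l - k)).ne' i (n := n)
  rwa [← pow_add, Nat.sub_add_cancel hkl] at h

theorem unitalSubringCount_prime_pow_le (n : ℕ) : ∃ K : ℝ, 1 ≤ K ∧ ∀ p : ℕ, p.Prime → ∀ l : ℕ,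
    (unitalSubringCount (Fin (n + 1) → ℤ) (p ^ l) : ℝ) ≤
      K * ((l : ℝ) + 1) ^ n * (p : ℝ) ^ (((n : ℝ) - 1) / 3 * l) := by
  induction n with
  | zero =>
    refine ⟨1, le_rfl, fun p hp l => ?_⟩
    have hbot : ∀ S : Subring (Fin 1 → ℤ), S = ⊤ := fun S => by
      refine (Subring.eq_top_iff' S).2 fun x => ?_
      have : x = ((x 0 : ℤ) : Fin 1 → ℤ) := by
        ext j
        simp [Subsingleton.elim j 0]
      rw [this]
      exact intCast_mem S _
    rcases Nat.eq_zero_or_pos l with rfl | hl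
    · have h : unitalSubringCount (Fin (0 + 1) → ℤ) (p ^ 0) ≤ 1 := by
        have : Subsingleton {S : Subring (Fin (0 + 1) → ℤ) // S.toAddSubgroup.index = p ^ 0} :=
          ⟨fun S T => Subtype.ext ((hbot S).trans (hbot T).symm)⟩
        exact Finite.card_le_one_iff_subsingleton.2 this
      simpa using h
    -- The exponent is negative when `n = 0`, but ℤ has no proper unital subring.
    · have h : unitalSubringCount (Fin (0 + 1) → ℤ) (p ^ l) = 0 := by
        have : IsEmpty {S : Subring (Fin (0 + 1) → ℤ) // S.toAddSubgroup.index = p ^ l} := by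
          refine ⟨fun S => ?_⟩
          have h1 := S.2
          rw [hbot S.1] at h1
          have h2 : (⊤ : Subring (Fin (0 + 1) → ℤ)).toAddSubgroup.index = 1 :=
            AddSubgroup.index_top
          rw [h2] at h1
          exact (Nat.one_lt_pow hl.ne' hp.one_lt).ne h1
        exact Nat.card_of_isEmpty
      rw [h]
      push_cast
      positivity
  | succ n ih =>
    obtain ⟨K, hK, ih⟩ := ih
    -- There are `n + 2` axes, and `2 ^ n` comes from the root counts; the at most `l + 1` values of
    -- `k` raise the degree by one.
    refine ⟨(n + 2) * (K * 2 ^ n), ?_, fun p hp l => ?_⟩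
    · have : (1 : ℝ) ≤ 2 ^ n := one_le_pow₀ (by norm_num)
      have h1 : (1 : ℝ) ≤ n + 2 := by linarith [(Nat.cast_nonneg n : (0 : ℝ) ≤ n)]
      exact one_le_mul_of_one_le_of_one_le h1 (one_le_mul_of_one_le_of_one_le hK this)
    have hp1 : (1 : ℝ) ≤ p := by exact_mod_cast hp.one_lt.le
    have hp0 : (0 : ℝ) < p := by linarith
    set E : ℝ := (p : ℝ) ^ ((((n + 1 : ℕ) : ℝ) - 1) / 3 * l) with hE
    have hterm : ∀ k ∈ (Finset.range (l + 1)).filter fun k => (n + 2) * k ≤ 2 * l,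
        ((unitalSubringCount (Fin (n + 1) → ℤ) (p ^ (l - k)) * (2 * p ^ (k / 2)) ^ n : ℕ) : ℝ) ≤
          K * ((l : ℝ) + 1) ^ n * 2 ^ n * E := by
      intro k hk
      rw [Finset.mem_filter, Finset.mem_range] at hk
      have hkl : k ≤ l := by omega
      have hk2 : ((n : ℝ) + 2) * k ≤ 2 * l := by exact_mod_cast hk.2
      have h1 := ih p hp (l - k)
      rw [Nat.cast_sub hkl] at h1
      have h2 : ((p : ℝ) ^ (k / 2)) ^ n ≤ (p : ℝ) ^ ((k : ℝ) / 2 * n) := by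
        rw [Real.rpow_mul hp0.le, Real.rpow_natCast, ← Real.rpow_natCast (p : ℝ) (k / 2)]
        gcongr
        exact Nat.cast_div_le
      have h3 : ((l : ℝ) - k + 1) ^ n ≤ ((l : ℝ) + 1) ^ n := by
        have : (k : ℝ) ≤ l := by exact_mod_cast hkl
        have : (0 : ℝ) ≤ k := k.cast_nonneg
        gcongr
        linarith
      -- The exponents add up to (n-1)l/3 + (n+2)k/6, and (n+2)k ≤ 2l makes this at most nl/3.
      have h4 : (p : ℝ) ^ (((n : ℝ) - 1) / 3 * ((l : ℝ) - k)) * (p : ℝ) ^ ((k : ℝ) / 2 * n) ≤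
          E := by
        rw [← Real.rpow_add hp0, hE]
        refine Real.rpow_le_rpow_of_exponent_le hp1 ?_
        push_cast
        linarith
      push_cast
      rw [mul_pow]
      calc _ ≤ (K * ((l : ℝ) + 1) ^ n * (p : ℝ) ^ (((n : ℝ) - 1) / 3 * ((l : ℝ) - k))) *
            (2 ^ n * (p : ℝ) ^ ((k : ℝ) / 2 * n)) := by
            refine mul_le_mul (h1.trans ?_) (by gcongr) (by positivity) (by positivity)
            gcongr
        _ = K * ((l : ℝ) + 1) ^ n * 2 ^ n * ((p : ℝ) ^ (((n : ℝ) - 1) / 3 * ((l : ℝ) - k)) *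
            (p : ℝ) ^ ((k : ℝ) / 2 * n)) := by ring
        _ ≤ _ := by gcongr
    calc (unitalSubringCount (Fin (n + 1 + 1) → ℤ) (p ^ l) : ℝ)
        ≤ _ := Nat.cast_le.2 (unitalSubringCount_prime_pow_le_sum hp l)
      _ ≤ ∑ _i : Fin (n + 2), ∑ k ∈ (Finset.range (l + 1)).filter fun k => (n + 2) * k ≤ 2 * l,
          K * ((l : ℝ) + 1) ^ n * 2 ^ n * E := by
        rw [Nat.cast_sum]
        refine Finset.sum_le_sum fun i _ => ?_
        rw [Nat.cast_sum]
        exact Finset.sum_le_sum hterm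
      _ ≤ ∑ _i : Fin (n + 2), ((l : ℝ) + 1) * (K * ((l : ℝ) + 1) ^ n * 2 ^ n * E) := by
        refine Finset.sum_le_sum fun i _ => ?_
        rw [Finset.sum_const, nsmul_eq_mul]
        have : ((((Finset.range (l + 1)).filter fun k => (n + 2) * k ≤ 2 * l).card : ℕ) : ℝ) ≤
            (l : ℝ) + 1 := by
          exact_mod_cast (Finset.card_filter_le _ _).trans (Finset.card_range _).le
        gcongr
      _ = _ := by
        rw [Finset.sum_const, Finset.card_univ, Fintype.card_fin, nsmul_eq_mul]
        push_cast
        ring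

/-! ### From prime powers to all indices. -/

/-- The subring `R + mA` of `A`. -/
def Subring.addMultiples {A : Type*} [CommRing A] (R : Subring A) (m : ℕ) : Subring A where
  carrier := {x | ∃ r ∈ R, ∃ y, x = r + m * y}
  mul_mem' := by
    rintro _ _ ⟨r, hr, y, rfl⟩ ⟨s, hs, z, rfl⟩
    exact ⟨r * s, R.mul_mem hr hs, r * z + y * s + m * y * z, by ring⟩
  one_mem' := ⟨1, R.one_mem, 0, by ring⟩
  add_mem' := by
    rintro _ _ ⟨r, hr, y, rfl⟩ ⟨s, hs, z, rfl⟩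
    exact ⟨r + s, R.add_mem hr hs, y + z, by ring⟩
  zero_mem' := ⟨0, R.zero_mem, 0, by ring⟩
  neg_mem' := by
    rintro _ ⟨r, hr, y, rfl⟩
    exact ⟨-r, R.neg_mem hr, -y, by ring⟩

theorem AddSubgroup.index_coprime_of_nsmul_mem {A : Type*} [AddCommGroup A] {H : AddSubgroup A}
    (h0 : H.index ≠ 0) {m n : ℕ} (hmn : m.Coprime n) (h : ∀ x, m • x ∈ H) :
    H.index.Coprime n := by
  refine Nat.coprime_of_dvd fun q hq hqH hqn => ?_
  have : Finite (A ⧸ H) := Nat.finite_of_card_ne_zero h0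
  have : Fact q.Prime := ⟨hq⟩
  obtain ⟨x, hx⟩ := exists_prime_addOrderOf_dvd_card' q hqH
  obtain ⟨a, rfl⟩ := QuotientAddGroup.mk_surjective x
  have hqm : q ∣ m := by
    rw [← hx]
    refine addOrderOf_dvd_of_nsmul_eq_zero ?_
    rw [← QuotientAddGroup.mk_nsmul]
    exact (QuotientAddGroup.eq_zero_iff _).2 (h a)
  exact hq.one_lt.ne' (Nat.eq_one_of_dvd_coprimes hmn hqm hqn)

/-- The index divides `m * n`, and is coprime to `n` because `m` kills A/(R + mA). -/
theorem Subring.index_addMultiples_dvd {A : Type*} [CommRing A] {R : Subring A} {m n : ℕ}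
    (hmn : m.Coprime n) (hm : m ≠ 0) (hn : n ≠ 0) (hR : R.toAddSubgroup.index = m * n) :
    (R.addMultiples m).toAddSubgroup.index ∣ m := by
  have hle : R.toAddSubgroup ≤ (R.addMultiples m).toAddSubgroup :=
    fun x hx => ⟨x, hx, 0, by ring⟩
  have hdvd := AddSubgroup.index_dvd_of_le hle
  rw [hR] at hdvd
  refine (AddSubgroup.index_coprime_of_nsmul_mem ?_ hmn fun x => ?_).dvd_of_dvd_mul_right hdvd
  · exact ne_zero_of_dvd_ne_zero (mul_ne_zero hm hn) hdvd
  · exact ⟨0, R.zero_mem, x, by rw [nsmul_eq_mul, zero_add]⟩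

theorem Subring.addMultiples_inf_addMultiples {A : Type*} [CommRing A] {R : Subring A} {m n : ℕ}
    (hmn : m.Coprime n) (hR : R.toAddSubgroup.index = m * n) :
    R.addMultiples m ⊓ R.addMultiples n = R := by
  refine le_antisymm ?_ fun x hx => ⟨⟨x, hx, 0, by ring⟩, ⟨x, hx, 0, by ring⟩⟩
  rintro x ⟨⟨r, hr, y, hxy⟩, ⟨s, hs, z, hxz⟩⟩
  obtain ⟨u, v, huv⟩ := Nat.isCoprime_iff_coprime.2 hmn
  have huv' : (u : A) * m + v * n = 1 := by exact_mod_cast congrArg (Int.cast : ℤ → A) huv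
  have hx : x = (u * m : ℤ) • s + (v * n : ℤ) • r + (m * n) • (u * z + v * y) := by
    simp only [zsmul_eq_mul, nsmul_eq_mul]
    push_cast
    linear_combination (-x) * huv' + (v : A) * n * hxy + (u : A) * m * hxz
  rw [hx]
  refine R.add_mem (R.add_mem (R.zsmul_mem hs _) (R.zsmul_mem hr _)) ?_
  rw [← hR]
  exact R.toAddSubgroup.nsmul_index_mem _

/-- `R` is the intersection of R + mA and R + nA. Their indices are at most `m` and `n` with product
at least `m * n`, so both are exact. -/
theorem unitalSubringCount_mul_le {d m n : ℕ} (hmn : m.Coprime n) (hm : m ≠ 0) (hn : n ≠ 0) :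
    unitalSubringCount (Fin d → ℤ) (m * n) ≤
      unitalSubringCount (Fin d → ℤ) m * unitalSubringCount (Fin d → ℤ) n := by
  have := finite_subrings_of_index d m hm
  have := finite_subrings_of_index d n hn
  have hidx : ∀ R : Subring (Fin d → ℤ), R.toAddSubgroup.index = m * n →
      (R.addMultiples m).toAddSubgroup.index = m ∧
        (R.addMultiples n).toAddSubgroup.index = n := by
    intro R hR
    have h1 := Nat.le_of_dvd (Nat.pos_of_ne_zero hm) (R.index_addMultiples_dvd hmn hm hn hR)
    have h2 := Nat.le_of_dvd (Nat.pos_of_ne_zero hn)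
      (R.index_addMultiples_dvd hmn.symm hn hm (hR.trans (mul_comm m n)))
    have h3 : m * n ≤ (R.addMultiples m).toAddSubgroup.index *
        (R.addMultiples n).toAddSubgroup.index := by
      have h := AddSubgroup.index_inf_le (H := (R.addMultiples m).toAddSubgroup)
        (K := (R.addMultiples n).toAddSubgroup)
      have e : (R.addMultiples m).toAddSubgroup ⊓ (R.addMultiples n).toAddSubgroup =
          R.toAddSubgroup :=
        congrArg Subring.toAddSubgroup (Subring.addMultiples_inf_addMultiples hmn hR)
      rwa [e, hR] at h
    have hm' := Nat.pos_of_ne_zero hm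
    have hn' := Nat.pos_of_ne_zero hn
    constructor <;> nlinarith
  let F : {R : Subring (Fin d → ℤ) // R.toAddSubgroup.index = m * n} →
      {S : Subring (Fin d → ℤ) // S.toAddSubgroup.index = m} ×
        {S : Subring (Fin d → ℤ) // S.toAddSubgroup.index = n} :=
    fun R => (⟨R.1.addMultiples m, (hidx R.1 R.2).1⟩, ⟨R.1.addMultiples n, (hidx R.1 R.2).2⟩)
  have hF : Function.Injective F := by
    rintro ⟨R, hR⟩ ⟨R', hR'⟩ h
    have h1 : R.addMultiples m = R'.addMultiples m := congrArg (fun z => z.1.1) h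
    have h2 : R.addMultiples n = R'.addMultiples n := congrArg (fun z => z.2.1) h
    refine Subtype.ext (show R = R' from ?_)
    rw [← Subring.addMultiples_inf_addMultiples hmn hR, h1, h2,
      Subring.addMultiples_inf_addMultiples hmn hR']
  have h := Nat.card_le_card_of_injective F hF
  rwa [Nat.card_prod] at h

/-- Polynomial factors at prime powers are absorbed by `k ^ ε` in a submultiplicative function. -/
theorem exists_le_mul_rpow_of_prime_pow_le {a : ℕ → ℕ} (h1 : a 1 ≤ 1)
    (hmul : ∀ m n : ℕ, m.Coprime n → m ≠ 0 → n ≠ 0 → a (m * n) ≤ a m * a n)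
    {K c : ℝ} {r : ℕ} (hK : 1 ≤ K)
    (h : ∀ p : ℕ, p.Prime → ∀ l : ℕ, (a (p ^ l) : ℝ) ≤ K * ((l : ℝ) + 1) ^ r * (p : ℝ) ^ (c * l))
    {ε : ℝ} (hε : 0 < ε) :
    ∃ C : ℝ, 0 < C ∧ ∀ k : ℕ, 1 ≤ k → (a k : ℝ) ≤ C * (k : ℝ) ^ (c + ε) := by
  obtain ⟨M, hM1, hM⟩ : ∃ M : ℝ, 1 ≤ M ∧ ∀ p : ℕ, p.Prime → ∀ l : ℕ,
      K * ((l : ℝ) + 1) ^ r ≤ M * (p : ℝ) ^ (ε / 2 * l) := by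
    set s : ℝ := (2 : ℝ) ^ (-(ε / 2)) with hs
    have hs0 : 0 < s := Real.rpow_pos_of_pos two_pos _
    have hs1 : s < 1 := Real.rpow_lt_one_of_one_lt_of_neg one_lt_two (by linarith)
    obtain ⟨b, hb⟩ := (tendsto_pow_const_mul_const_pow_of_abs_lt_one r
      (by rwa [abs_of_pos hs0] : |s| < 1)).bddAbove_range
    -- Since p ≥ 2, a constant that works for 2 works for every prime; dividing by `s` undoes the
    -- shift from `l` to `l + 1`.
    refine ⟨max 1 (K * b / s), le_max_left _ _, fun p hp l => ?_⟩
    have hbl : ((l + 1 : ℕ) : ℝ) ^ r * s ^ (l + 1) ≤ b := hb ⟨l + 1, rfl⟩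
    have hp2 : (2 : ℝ) ≤ p := by exact_mod_cast hp.two_le
    have hsl : s ^ l * (2 : ℝ) ^ (ε / 2 * l) = 1 := by
      rw [hs, ← Real.rpow_natCast, ← Real.rpow_mul two_pos.le, ← Real.rpow_add two_pos,
        show -(ε / 2) * (l : ℝ) + ε / 2 * l = 0 by ring, Real.rpow_zero]
    have h2 : K * ((l : ℝ) + 1) ^ r ≤ K * b / s * (2 : ℝ) ^ (ε / 2 * l) := by
      rw [div_mul_eq_mul_div, le_div_iff₀ hs0]
      push_cast at hbl
      calc K * ((l : ℝ) + 1) ^ r * s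
          = K * (((l : ℝ) + 1) ^ r * s ^ (l + 1)) * (2 : ℝ) ^ (ε / 2 * l) := by
            rw [pow_succ s]
            linear_combination (-(K * ((l : ℝ) + 1) ^ r * s)) * hsl
        _ ≤ _ := by gcongr
    refine h2.trans (mul_le_mul (le_max_right _ _) ?_ (by positivity) (by positivity))
    gcongr
  obtain ⟨P, hP⟩ : ∃ P : ℕ, ∀ p : ℕ, P ≤ p → M ≤ (p : ℝ) ^ (ε / 2) :=
    Filter.eventually_atTop.1 (((tendsto_rpow_atTop (half_pos hε)).comp
      tendsto_natCast_atTop_atTop).eventually_ge_atTop M)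
  -- Only primes below `P` cost a factor `M`; larger ones absorb it in the second half of ε.
  let small : ℕ → Finset ℕ := fun k => k.primeFactors.filter (· < P)
  have key : ∀ k : ℕ, 1 ≤ k → (a k : ℝ) ≤ M ^ (small k).card * (k : ℝ) ^ (c + ε) := by
    intro k
    induction k using Nat.recOnPosPrimePosCoprime with
    | zero => intro h; omega
    | one => intro _; simpa [small] using h1
    | prime_pow p l hp hl =>
      intro _
      have hp0 : (0 : ℝ) ≤ p := p.cast_nonneg
      have hp1 : (1 : ℝ) ≤ p := by exact_mod_cast hp.one_lt.le
      have hpp : (0 : ℝ) < p := by linarith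
      have hl1 : (1 : ℝ) ≤ l := by exact_mod_cast hl
      have hsplit : ((p ^ l : ℕ) : ℝ) ^ (c + ε) =
          (p : ℝ) ^ (ε / 2 * l) * ((p : ℝ) ^ (ε / 2 * l) * (p : ℝ) ^ (c * l)) := by
        rw [← Real.rpow_add hpp, ← Real.rpow_add hpp, Nat.cast_pow, ← Real.rpow_natCast,
          ← Real.rpow_mul hp0]
        congr 1
        ring
      have hMp : M ≤ M ^ (small (p ^ l)).card * (p : ℝ) ^ (ε / 2 * l) := by
        have hge : (p : ℝ) ^ (ε / 2) ≤ (p : ℝ) ^ (ε / 2 * l) :=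
          Real.rpow_le_rpow_of_exponent_le hp1 (by nlinarith)
        by_cases hpP : p < P
        · have : small (p ^ l) = {p} := by
            simp only [small, Nat.primeFactors_prime_pow hl.ne' hp]
            exact Finset.filter_eq_self.2 (by simpa using hpP)
          rw [this, Finset.card_singleton, pow_one]
          exact le_mul_of_one_le_right (by linarith)
            (Real.one_le_rpow hp1 (by positivity))
        · exact (hP p (not_lt.1 hpP)).trans (hge.trans
            (le_mul_of_one_le_left (by positivity) (one_le_pow₀ hM1)))
      rw [hsplit]
      calc (a (p ^ l) : ℝ) ≤ K * ((l : ℝ) + 1) ^ r * (p : ℝ) ^ (c * l) := h p hp l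
        _ ≤ M * (p : ℝ) ^ (ε / 2 * l) * (p : ℝ) ^ (c * l) := by
          exact mul_le_mul_of_nonneg_right (hM p hp l) (by positivity)
        _ ≤ M ^ (small (p ^ l)).card * (p : ℝ) ^ (ε / 2 * l) * (p : ℝ) ^ (ε / 2 * l) *
            (p : ℝ) ^ (c * l) := by gcongr
        _ = _ := by ring
    | coprime m n hm hn hmn ihm ihn =>
      intro _
      have hcard : (small (m * n)).card = (small m).card + (small n).card := by
        simp only [small]
        rw [hmn.primeFactors_mul, Finset.filter_union, Finset.card_union_of_disjoint]
        exact Finset.disjoint_filter_filter hmn.disjoint_primeFactors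
      rw [hcard, pow_add, Nat.cast_mul, Real.mul_rpow m.cast_nonneg n.cast_nonneg]
      calc (a (m * n) : ℝ) ≤ a m * a n := by
            exact_mod_cast hmul m n hmn (by omega) (by omega)
        _ ≤ _ := mul_le_mul (ihm hm.le) (ihn hn.le) (Nat.cast_nonneg _) (by positivity)
        _ = _ := by ring
  refine ⟨M ^ P, by positivity, fun k hk => (key k hk).trans ?_⟩
  gcongr
  refine (Finset.card_le_card (t := Finset.range P) fun q hq => ?_).trans
    (Finset.card_range P).le
  exact Finset.mem_range.2 (Finset.mem_filter.1 hq).2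

theorem corollary4 (d : ℕ) (hd : 6 ≤ d) :
    (∃ D : Polynomial ℝ, ∀ p : ℕ, p.Prime → ∀ l : ℕ,
      (unitalSubringCount (Fin d → ℤ) (p ^ l) : ℝ) ≤
        D.eval (l : ℝ) * (p : ℝ) ^ (((d : ℝ) / 2 - 5 / 3) * (l : ℝ))) ∧
    (∀ ε : ℝ, 0 < ε → ∃ C : ℝ, 0 < C ∧ ∀ k : ℕ, 1 ≤ k →
      (unitalSubringCount (Fin d → ℤ) k : ℝ) ≤ C * (k : ℝ) ^ ((d : ℝ) / 2 - 5 / 3 + ε)) := by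
  obtain ⟨n, rfl⟩ : ∃ n, d = n + 1 := ⟨d - 1, by omega⟩
  obtain ⟨K, hK, h⟩ := unitalSubringCount_prime_pow_le n
  have hn : (5 : ℝ) ≤ n := by exact_mod_cast (by omega : 5 ≤ n)
  have hbound : ∀ p : ℕ, p.Prime → ∀ l : ℕ,
      (unitalSubringCount (Fin (n + 1) → ℤ) (p ^ l) : ℝ) ≤ K * ((l : ℝ) + 1) ^ n *
        (p : ℝ) ^ ((((n + 1 : ℕ) : ℝ) / 2 - 5 / 3) * (l : ℝ)) := by
    intro p hp l
    refine (h p hp l).trans ?_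
    have hp1 : (1 : ℝ) ≤ p := by exact_mod_cast hp.one_lt.le
    -- What remains is (n-1)/3 ≤ (n+1)/2 - 5/3, that is, n ≥ 5.
    gcongr
    push_cast
    linarith
  refine ⟨⟨.C K * (.X + 1) ^ n, fun p hp l => by simpa using hbound p hp l⟩, fun ε hε => ?_⟩
  refine exists_le_mul_rpow_of_prime_pow_le ?_
    (fun a b hab ha hb => unitalSubringCount_mul_le hab ha hb) hK hbound hε
  have : Subsingleton {S : Subring (Fin (n + 1) → ℤ) // S.toAddSubgroup.index = 1} := by
    refine ⟨fun S T => Subtype.ext (SetLike.ext fun x => ?_)⟩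
    have hS : x ∈ S.1.toAddSubgroup := by rw [AddSubgroup.index_eq_one.1 S.2]; trivial
    have hT : x ∈ T.1.toAddSubgroup := by rw [AddSubgroup.index_eq_one.1 T.2]; trivial
    exact ⟨fun _ => hT, fun _ => hS⟩
  exact Finite.card_le_one_iff_subsingleton.2 this
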